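/- Let $N\ge 2$ and let $V=(v_{ij})_{1\le i,j\le N}$ be an $N\times N$ matrix from the circular orthogonal ensemble (COE), that is, a random symmetric unitary complex matrix whose distribution is invariant under $V\mapsto U_0^{\mathsf T}\,V\,U_0$ for every fixed $N\times N$ unitary matrix $U_0$ (equivalently, $V$ has the distribution of $U^{\mathsf T}U$ with $U$ a Haar-distributed $N\times N$ unitary matrix). Then for all indices $i\neq j$ and every integer $n\ge 1$, $$ \mathbb{E}\big[|v_{ij}|^{2n}\big]=\frac{n!}{(N+2n-1)\,\prod_{k=0}^{n-2}(N+k)}, $$ where the empty product (the case $n=1$) equals $1$. -/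

import Mathlib

open MeasureTheory
open scoped Matrix

/-- The entrywise (product) σ-algebra on complex `N × N` matrices; it is the Borel σ-algebra of
the usual topology. -/
noncomputable instance matrixMeasurableSpace (N : ℕ) :
    MeasurableSpace (Matrix (Fin N) (Fin N) ℂ) :=
  (MeasurableSpace.pi : MeasurableSpace (Fin N → Fin N → ℂ))

/-- `IsCOE V P`: under the probability measure `P`, the random `N × N` matrix `V` is a matrix from
the circular orthogonal ensemble, i.e. a random symmetric unitary matrix whose law is invariant
under `V ↦ U₀ᵀ V U₀` for every fixed unitary matrix `U₀`. -/
structure IsCOE {Ω : Type*} [MeasurableSpace Ω] {N : ℕ}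
    (V : Ω → Matrix (Fin N) (Fin N) ℂ) (P : Measure Ω) : Prop where
  isProbabilityMeasure : IsProbabilityMeasure P
  aemeasurable : AEMeasurable V P
  symmetric : ∀ᵐ ω ∂P, (V ω).IsSymm
  unitary : ∀ᵐ ω ∂P, V ω ∈ Matrix.unitaryGroup (Fin N) ℂ
  invariant : ∀ U₀ ∈ Matrix.unitaryGroup (Fin N) ℂ,
    P.map (fun ω => U₀ᵀ * V ω * U₀) = P.map V

/-!
Fix a row `i` and write `x = |v_ii|²`, `r = 1 - x = ∑_{k ≠ i} |v_ik|²`, `y = |v_ij|²`. The moments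
are computed by integration by parts on the unitary group: if `R t` is a one-parameter group of
unitary matrices, then `t ↦ E[F ((R t)ᵀ V (R t))]` is constant, so its derivative at `0`, the
expectation of an explicit polynomial in the entries of `V`, vanishes
(`IsCOE.integral_deriv_eq_zero`). Real rotations of a coordinate plane suffice as one-parameter
groups, because the unwanted terms change sign when one basis vector is multiplied by the phase
`√-1` and hence have zero mean (`IsCOE.integral_eq_zero_of_odd`).

* Rotating the `(i, k)`-plane with `F = r ^ m * Re (v_ii * conj v_ik)` and summing over `k ≠ i`
  gives `(N + 2m + 1) E[r ^ (m + 1)] = (N + 2m - 1) E[r ^ m]`, which telescopes to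
  `(N + 2n - 1) E[r ^ n] = N - 1` (`IsCOE.integral_diag_pow`). Symmetry of `V` enters here: by
  `v_ki = v_ik`, the two factors `Uᵀ` and `U` change `v_ii` at the same rate `v_ik`.
* Rotating the `(j, k)`-plane with `F = r ^ p * y ^ q * Re (v_ij * conj v_ik)` and summing over
  `k ∉ {i, j}` gives `(N - 1 + q) E[r ^ p y ^ (q + 1)] = (q + 1) E[r ^ (p + 1) y ^ q]`, hence
  `(N - 1) N ⋯ (N + n - 2) E[y ^ n] = n! E[r ^ n]` (`IsCOE.prod_mul_integral_offDiag_pow`). This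
  is the statement that the off-diagonal part of row `i` is uniform on its sphere.

Multiplying the two identities and cancelling `N - 1` gives the moment formula.
-/

open Filter ComplexConjugate

/-! ### Integrals of continuous functions of the matrix -/

instance matrixBorelSpace (N : ℕ) : BorelSpace (Matrix (Fin N) (Fin N) ℂ) :=
  inferInstanceAs (BorelSpace (Fin N → Fin N → ℂ))

lemma exists_bound_on_unitaryGroup {N : ℕ} {G : Matrix (Fin N) (Fin N) ℂ → ℝ}
    (hG : Continuous G) : ∃ C, ∀ M ∈ Matrix.unitaryGroup (Fin N) ℂ, ‖G M‖ ≤ C := by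
  have hK : IsCompact (Set.univ.pi fun _ : Fin N => Set.univ.pi fun _ : Fin N =>
      Metric.closedBall (0 : ℂ) 1) :=
    isCompact_univ_pi fun _ => isCompact_univ_pi fun _ => isCompact_closedBall _ _
  obtain ⟨C, hC⟩ := hK.exists_bound_of_continuousOn (f := G) hG.continuousOn
  exact ⟨C, fun M hM => hC M fun p _ q _ =>
    mem_closedBall_zero_iff.2 (entry_norm_bound_of_unitary hM p q)⟩

namespace IsCOE

variable {Ω : Type*} [MeasurableSpace Ω] {P : Measure Ω} {N : ℕ}
  {V : Ω → Matrix (Fin N) (Fin N) ℂ}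

lemma integrable_comp (hV : IsCOE V P) {G : Matrix (Fin N) (Fin N) ℂ → ℝ} (hG : Continuous G) :
    Integrable (fun ω => G (V ω)) P := by
  have := hV.isProbabilityMeasure
  obtain ⟨C, hC⟩ := exists_bound_on_unitaryGroup hG
  exact .of_bound (hG.measurable.comp_aemeasurable hV.aemeasurable).aestronglyMeasurable C
    (hV.unitary.mono fun ω h => hC _ h)

lemma integral_comp_congr (hV : IsCOE V P) {G : Matrix (Fin N) (Fin N) ℂ → ℝ}
    (hG : Continuous G) {U : Matrix (Fin N) (Fin N) ℂ} (hU : U ∈ Matrix.unitaryGroup (Fin N) ℂ) :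
    ∫ ω, G (Uᵀ * V ω * U) ∂P = ∫ ω, G (V ω) ∂P := by
  have hc : Continuous fun M : Matrix (Fin N) (Fin N) ℂ => Uᵀ * M * U := by fun_prop
  have h := congrArg (fun μ => ∫ M, G M ∂μ) (hV.invariant U hU)
  rwa [show (fun ω => Uᵀ * V ω * U) = (fun M => Uᵀ * M * U) ∘ V from rfl,
    integral_map (hc.measurable.comp_aemeasurable hV.aemeasurable)
      hG.measurable.aestronglyMeasurable,
    integral_map hV.aemeasurable hG.measurable.aestronglyMeasurable] at h

/-- A function of `V` that some unitary change of variables negates has mean zero. -/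
lemma integral_eq_zero_of_odd (hV : IsCOE V P) {G : Matrix (Fin N) (Fin N) ℂ → ℝ}
    (hG : Continuous G) {U : Matrix (Fin N) (Fin N) ℂ} (hU : U ∈ Matrix.unitaryGroup (Fin N) ℂ)
    (hodd : ∀ M, G (Uᵀ * M * U) = -G M) : ∫ ω, G (V ω) ∂P = 0 := by
  have h := hV.integral_comp_congr hG hU
  simp only [hodd, integral_neg] at h
  linarith

/-- Integration by parts along a one-parameter unitary group `R`: the derivative `D` of `F` along
the flow `M ↦ (R t)ᵀ M (R t)` has mean zero. -/
lemma integral_deriv_eq_zero (hV : IsCOE V P) {R : ℝ → Matrix (Fin N) (Fin N) ℂ}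
    (hR : ∀ t, R t ∈ Matrix.unitaryGroup (Fin N) ℂ) (hadd : ∀ s t, R (s + t) = R s * R t)
    (hR0 : R 0 = 1)
    {F D : Matrix (Fin N) (Fin N) ℂ → ℝ} (hF : Continuous F) (hD : Continuous D)
    (hFD : ∀ M, HasDerivAt (fun t => F ((R t)ᵀ * M * R t)) (D M) 0) :
    ∫ ω, D (V ω) ∂P = 0 := by
  have := hV.isProbabilityMeasure
  have htr : ∀ U ∈ Matrix.unitaryGroup (Fin N) ℂ, Uᵀ ∈ Matrix.unitaryGroup (Fin N) ℂ := by
    intro U hU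
    have h := congrArg Matrix.transpose (Matrix.mem_unitaryGroup_iff'.1 hU)
    rw [Matrix.transpose_mul, Matrix.transpose_one] at h
    exact Matrix.mem_unitaryGroup_iff.2 h
  obtain ⟨C, hC⟩ := exists_bound_on_unitaryGroup hD
  have hc : ∀ t, Continuous fun M : Matrix (Fin N) (Fin N) ℂ => (R t)ᵀ * M * R t := by
    intro t; fun_prop
  -- By the group law, the derivative at time `t` is the derivative at time `0` from the point
  -- reached at time `t`.
  have hderiv : ∀ M t, HasDerivAt (fun s => F ((R s)ᵀ * M * R s)) (D ((R t)ᵀ * M * R t)) t := by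
    intro M t
    have h := hFD ((R t)ᵀ * M * R t)
    rw [← sub_self t] at h
    refine (h.comp_sub_const t t).congr_of_eventuallyEq (.of_forall fun s => ?_)
    have hs : R s = R t * R (s - t) := by rw [← hadd]; congr 1; ring
    simp only [hs, Matrix.transpose_mul, Matrix.mul_assoc]
  have key := hasDerivAt_integral_of_dominated_loc_of_deriv_le (μ := P) (x₀ := (0 : ℝ))
    (s := Set.univ) (F := fun t ω => F ((R t)ᵀ * V ω * R t))
    (F' := fun t ω => D ((R t)ᵀ * V ω * R t)) (bound := fun _ => C) univ_mem
    (.of_forall fun t => (hV.integrable_comp (hF.comp (hc t))).aestronglyMeasurable)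
    (hV.integrable_comp (hF.comp (hc 0)))
    (hV.integrable_comp (hD.comp (hc 0))).aestronglyMeasurable
    (hV.unitary.mono fun ω h t _ => hC _ (mul_mem (mul_mem (htr _ (hR t)) h) (hR t)))
    (integrable_const C) (.of_forall fun ω t _ => hderiv (V ω) t)
  have h := key.2
  simp only [hV.integral_comp_congr hF (hR _), hR0, Matrix.transpose_one, one_mul, mul_one] at h
  exact h.unique (hasDerivAt_const _ _)

end IsCOE

/-! ### Plane rotations and phases -/

/-- The rotation by the angle `t` in the plane of the coordinates `a` and `k` (for `a ≠ k`), fixing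
all other coordinates; column `a` of `M * planeRotation a k t` is
`cos t • M_a + sin t • M_k`. -/
noncomputable def planeRotation {N : ℕ} (a k : Fin N) (t : ℝ) : Matrix (Fin N) (Fin N) ℂ :=
  1 + ((Real.cos t : ℂ) - 1) • (Matrix.single a a 1 + Matrix.single k k 1) +
    (Real.sin t : ℂ) • (Matrix.single k a 1 - Matrix.single a k 1)

section planeRotation

variable {N : ℕ} {a k : Fin N}

@[simp] lemma planeRotation_zero : planeRotation a k 0 = 1 := by simp [planeRotation]

lemma planeRotation_add (hak : a ≠ k) (s t : ℝ) :
    planeRotation a k (s + t) = planeRotation a k s * planeRotation a k t := by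
  simp only [planeRotation, Real.cos_add, Real.sin_add, Complex.ofReal_sub, Complex.ofReal_add,
    Complex.ofReal_mul]
  generalize (Real.cos s : ℂ) = c
  generalize (Real.sin s : ℂ) = d
  generalize (Real.cos t : ℂ) = c'
  generalize (Real.sin t : ℂ) = d'
  simp only [mul_add, add_mul, mul_sub, sub_mul, smul_mul_assoc, mul_smul_comm, one_mul, mul_one,
    Matrix.single_mul_single_same, Matrix.single_mul_single_of_ne _ _ _ _ hak,
    Matrix.single_mul_single_of_ne _ _ _ _ hak.symm]
  simp only [smul_add, smul_sub, sub_zero, zero_sub, add_zero, zero_add, smul_neg]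
  module

lemma planeRotation_mem_unitaryGroup (hak : a ≠ k) (t : ℝ) :
    planeRotation a k t ∈ Matrix.unitaryGroup (Fin N) ℂ := by
  have hstar : star (planeRotation a k t) = planeRotation a k (-t) := by
    simp only [planeRotation, Matrix.star_eq_conjTranspose, Matrix.conjTranspose_add,
      Matrix.conjTranspose_sub, Matrix.conjTranspose_smul, Matrix.conjTranspose_single,
      Matrix.conjTranspose_one, Real.cos_neg, Real.sin_neg, star_sub, star_one, Complex.star_def,
      Complex.conj_ofReal, Complex.ofReal_neg]
    module
  rw [Matrix.mem_unitaryGroup_iff, hstar, ← planeRotation_add hak, add_neg_cancel,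
    planeRotation_zero]

lemma hasDerivAt_planeRotation_apply (p q : Fin N) :
    HasDerivAt (fun t => planeRotation a k t p q)
      ((Matrix.single k a 1 - Matrix.single a k 1 : Matrix (Fin N) (Fin N) ℂ) p q) 0 := by
  have hc : HasDerivAt (fun t : ℝ => (Real.cos t : ℂ)) 0 0 := by
    simpa using (Real.hasDerivAt_cos 0).ofReal_comp
  have hs : HasDerivAt (fun t : ℝ => (Real.sin t : ℂ)) 1 0 := by
    simpa using (Real.hasDerivAt_sin 0).ofReal_comp
  have h := (((hc.sub_const 1).mul_const
    ((Matrix.single a a 1 + Matrix.single k k 1 : Matrix (Fin N) (Fin N) ℂ) p q)).const_add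
    ((1 : Matrix (Fin N) (Fin N) ℂ) p q)).add (hs.mul_const
    ((Matrix.single k a 1 - Matrix.single a k 1 : Matrix (Fin N) (Fin N) ℂ) p q))
  rw [zero_mul, one_mul, zero_add] at h
  exact h

/-- The entries of `JᵀM + MJ`, where `J = E_ka - E_ak` generates the rotations. -/
lemma hasDerivAt_planeRotation_conj (M : Matrix (Fin N) (Fin N) ℂ) (p q : Fin N) :
    HasDerivAt (fun t => ((planeRotation a k t)ᵀ * M * planeRotation a k t) p q)
      (((if p = a then M k q else 0) - (if p = k then M a q else 0)) +
        ((if q = a then M p k else 0) - (if q = k then M p a else 0))) 0 := by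
  have h := HasDerivAt.fun_sum (u := Finset.univ) fun x (_ : x ∈ Finset.univ) =>
    (HasDerivAt.fun_sum (u := Finset.univ) fun y (_ : y ∈ Finset.univ) =>
      (hasDerivAt_planeRotation_apply (a := a) (k := k) y p).mul_const (M y x)).fun_mul
    (hasDerivAt_planeRotation_apply (a := a) (k := k) x q)
  simp only [Matrix.mul_apply, Matrix.transpose_apply]
  refine h.congr_deriv ?_
  symm
  simp only [planeRotation_zero, Finset.sum_add_distrib, Matrix.one_apply, Matrix.sub_apply,
    Matrix.single_apply, sub_mul, mul_sub, Finset.sum_sub_distrib, ite_mul, mul_ite, ite_and,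
    one_mul, mul_one, zero_mul, mul_zero, Finset.sum_ite_eq',
    Finset.mem_univ, if_true, eq_comm (a := a), eq_comm (a := k)]

end planeRotation

/-- The diagonal unitary matrix with entry `i` (the imaginary unit) at `k` and `1` elsewhere. -/
noncomputable def quarterPhase {N : ℕ} (k : Fin N) : Matrix (Fin N) (Fin N) ℂ :=
  Matrix.diagonal fun p => if p = k then Complex.I else 1

lemma quarterPhase_mem_unitaryGroup {N : ℕ} (k : Fin N) :
    quarterPhase k ∈ Matrix.unitaryGroup (Fin N) ℂ := by
  rw [Matrix.mem_unitaryGroup_iff, quarterPhase, Matrix.star_eq_conjTranspose,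
    Matrix.diagonal_conjTranspose, Matrix.diagonal_mul_diagonal, ← Matrix.diagonal_one]
  congr 1
  funext p
  by_cases hp : p = k <;> simp [hp]

lemma quarterPhase_conj_apply {N : ℕ} (k : Fin N) (M : Matrix (Fin N) (Fin N) ℂ) (p q : Fin N) :
    ((quarterPhase k)ᵀ * M * quarterPhase k) p q =
      (if p = k then Complex.I else 1) * M p q * (if q = k then Complex.I else 1) := by
  simp [quarterPhase, Matrix.mul_diagonal, Matrix.diagonal_mul]

/-! ### Derivatives and row sums -/

lemma HasDerivAt.re_mul_conj {u v : ℝ → ℂ} {u' v' : ℂ} {t : ℝ} (hu : HasDerivAt u u' t)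
    (hv : HasDerivAt v v' t) :
    HasDerivAt (fun s => (u s * conj (v s)).re) (u' * conj (v t) + u t * conj v').re t :=
  Complex.reCLM.hasFDerivAt.comp_hasDerivAt t (hu.fun_mul hv.star)

lemma HasDerivAt.normSq {u : ℝ → ℂ} {u' : ℂ} {t : ℝ} (hu : HasDerivAt u u' t) :
    HasDerivAt (fun s => Complex.normSq (u s)) (2 * (u' * conj (u t)).re) t := by
  have h := hu.re_mul_conj hu
  simp only [Complex.mul_conj, Complex.ofReal_re] at h
  refine h.congr_deriv ?_
  simp only [Complex.add_re, Complex.mul_re, Complex.conj_re, Complex.conj_im]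
  ring

lemma sum_normSq_row {N : ℕ} {M : Matrix (Fin N) (Fin N) ℂ}
    (hM : M ∈ Matrix.unitaryGroup (Fin N) ℂ) (i : Fin N) : ∑ k, Complex.normSq (M i k) = 1 := by
  have h := congrFun (congrFun (Matrix.mem_unitaryGroup_iff.1 hM) i) i
  simp only [Matrix.mul_apply, Matrix.star_apply, Complex.star_def, Complex.mul_conj,
    Matrix.one_apply_eq] at h
  exact_mod_cast h

/-! ### Moment recursions -/

namespace IsCOE

variable {Ω : Type*} [MeasurableSpace Ω] {P : Measure Ω} {N : ℕ}
  {V : Ω → Matrix (Fin N) (Fin N) ℂ}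

/-- Integration by parts for `r ^ m * Re (v_ii * conj v_ik)`, `r = 1 - |v_ii|²`, along the
rotations of the `(i, k)`-plane. -/
lemma integral_diag_rotation (hV : IsCOE V P) {i k : Fin N} (hki : k ≠ i) (m : ℕ) :
    ∫ ω, ((1 - Complex.normSq (V ω i i)) ^ m *
        (2 * Complex.normSq (V ω i k) - Complex.normSq (V ω i i)) -
      2 * m * (1 - Complex.normSq (V ω i i)) ^ (m - 1) * Complex.normSq (V ω i i) *
        Complex.normSq (V ω i k)) ∂P = 0 := by
  have hnsq := Complex.continuous_normSq
  let F : Matrix (Fin N) (Fin N) ℂ → ℝ := fun M =>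
    (1 - Complex.normSq (M i i)) ^ m * (M i i * conj (M i k)).re
  let D : Matrix (Fin N) (Fin N) ℂ → ℝ := fun M =>
    (m * (1 - Complex.normSq (M i i)) ^ (m - 1) *
        -(2 * ((M k i + M i k) * conj (M i i)).re)) * (M i i * conj (M i k)).re +
      (1 - Complex.normSq (M i i)) ^ m *
        ((M k i + M i k) * conj (M i k) + M i i * conj (M k k - M i i)).re
  -- On symmetric matrices `D` is the wanted integrand plus `G`, and the phase at `k` negates `G`.
  let G : Matrix (Fin N) (Fin N) ℂ → ℝ := fun M =>
    (1 - Complex.normSq (M i i)) ^ m * (M i i * conj (M k k)).re -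
      2 * m * (1 - Complex.normSq (M i i)) ^ (m - 1) * ((M i k * conj (M i i)) ^ 2).re
  have hF : Continuous F := by fun_prop
  have hD : Continuous D := by fun_prop
  have hG : Continuous G := by fun_prop
  have hD0 : ∫ ω, D (V ω) ∂P = 0 := by
    refine hV.integral_deriv_eq_zero (planeRotation_mem_unitaryGroup hki.symm)
      (planeRotation_add hki.symm) planeRotation_zero hF hD fun M => ?_
    have hii := hasDerivAt_planeRotation_conj (a := i) (k := k) M i i
    have hik := hasDerivAt_planeRotation_conj (a := i) (k := k) M i k
    have h := ((hii.normSq.const_sub 1).fun_pow m).fun_mul (hii.re_mul_conj hik)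
    refine h.congr_deriv ?_
    simp only [D, hki, hki.symm, if_true, if_false, planeRotation_zero, Matrix.transpose_one, one_mul,
      mul_one, sub_zero, zero_sub, ← sub_eq_add_neg]
  have hG0 : ∫ ω, G (V ω) ∂P = 0 := by
    refine hV.integral_eq_zero_of_odd hG (quarterPhase_mem_unitaryGroup k) fun M => ?_
    simp only [G, quarterPhase_conj_apply, hki.symm, if_true, if_false, one_mul, mul_one]
    simp only [pow_two, Complex.mul_re, Complex.mul_im, Complex.conj_re, Complex.conj_im,
      Complex.I_re, Complex.I_im]
    ring
  rw [← sub_zero (0 : ℝ)]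
  nth_rewrite 1 [← hD0]
  rw [← hG0, ← integral_sub (hV.integrable_comp hD) (hV.integrable_comp hG)]
  refine integral_congr_ae (hV.symmetric.mono fun ω h => ?_)
  simp only [D, G, h.apply i k, Complex.normSq_apply, pow_two, Complex.mul_re, Complex.mul_im,
    Complex.add_re, Complex.add_im, Complex.sub_re, Complex.sub_im, Complex.conj_re,
    Complex.conj_im]
  ring

/-- Integration by parts for `r ^ p * |v_ij| ^ (2q) * Re (v_ij * conj v_ik)`, `r = 1 - |v_ii|²`,
along the rotations of the `(j, k)`-plane, which fix `v_ii`. -/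
lemma integral_offDiag_rotation (hV : IsCOE V P) {i j k : Fin N} (hji : j ≠ i) (hki : k ≠ i)
    (hkj : k ≠ j) (p q : ℕ) :
    ∫ ω, ((1 - Complex.normSq (V ω i i)) ^ p * Complex.normSq (V ω i j) ^ q *
      ((q + 1) * Complex.normSq (V ω i k) - Complex.normSq (V ω i j))) ∂P = 0 := by
  have hnsq := Complex.continuous_normSq
  let F : Matrix (Fin N) (Fin N) ℂ → ℝ := fun M =>
    (1 - Complex.normSq (M i i)) ^ p * (Complex.normSq (M i j) ^ q * (M i j * conj (M i k)).re)
  let D : Matrix (Fin N) (Fin N) ℂ → ℝ := fun M => (1 - Complex.normSq (M i i)) ^ p *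
    ((q * Complex.normSq (M i j) ^ (q - 1) * (2 * (M i k * conj (M i j)).re)) *
        (M i j * conj (M i k)).re +
      Complex.normSq (M i j) ^ q * (Complex.normSq (M i k) - Complex.normSq (M i j)))
  -- `D` is the wanted integrand plus `G`, and the phase at `k` negates `G`.
  let G : Matrix (Fin N) (Fin N) ℂ → ℝ := fun M => (1 - Complex.normSq (M i i)) ^ p *
    (q * Complex.normSq (M i j) ^ (q - 1) * ((M i k * conj (M i j)) ^ 2).re)
  have hF : Continuous F := by fun_prop
  have hD : Continuous D := by fun_prop
  have hG : Continuous G := by fun_prop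
  have hD0 : ∫ ω, D (V ω) ∂P = 0 := by
    refine hV.integral_deriv_eq_zero (planeRotation_mem_unitaryGroup hkj.symm)
      (planeRotation_add hkj.symm) planeRotation_zero hF hD fun M => ?_
    have hii := hasDerivAt_planeRotation_conj (a := j) (k := k) M i i
    have hij := hasDerivAt_planeRotation_conj (a := j) (k := k) M i j
    have hik := hasDerivAt_planeRotation_conj (a := j) (k := k) M i k
    have h := ((hii.normSq.const_sub 1).fun_pow p).fun_mul
      ((hij.normSq.fun_pow q).fun_mul (hij.re_mul_conj hik))
    refine h.congr_deriv ?_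
    simp only [D, hki.symm, hkj, hkj.symm, hji.symm, if_true, if_false, planeRotation_zero,
      Matrix.transpose_one, one_mul,
      mul_one, sub_zero, zero_sub, add_zero, zero_add,
      Complex.normSq_apply, Complex.add_re, Complex.mul_re, Complex.conj_re,
      Complex.conj_im, Complex.neg_re, Complex.neg_im, Complex.zero_re, Complex.zero_im]
    ring
  have hG0 : ∫ ω, G (V ω) ∂P = 0 := by
    refine hV.integral_eq_zero_of_odd hG (quarterPhase_mem_unitaryGroup k) fun M => ?_
    simp only [G, quarterPhase_conj_apply, hki.symm, hkj.symm, if_true, if_false, one_mul, mul_one]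
    simp only [pow_two, Complex.mul_re, Complex.mul_im, Complex.conj_re, Complex.conj_im,
      Complex.I_re, Complex.I_im]
    ring
  rw [← sub_zero (0 : ℝ)]
  nth_rewrite 1 [← hD0]
  rw [← hG0, ← integral_sub (hV.integrable_comp hD) (hV.integrable_comp hG)]
  refine integral_congr_ae (.of_forall fun ω => ?_)
  -- The truncated exponent `q - 1` is harmless, as the factor `q` vanishes for `q = 0`.
  have hq : (q : ℝ) * Complex.normSq (V ω i j) ^ q =
      q * Complex.normSq (V ω i j) ^ (q - 1) * Complex.normSq (V ω i j) := by
    cases q <;> simp [pow_succ, mul_assoc]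
  have hz : 2 * (V ω i k * conj (V ω i j)).re * (V ω i j * conj (V ω i k)).re =
      Complex.normSq (V ω i j) * Complex.normSq (V ω i k) +
        ((V ω i k * conj (V ω i j)) ^ 2).re := by
    simp only [Complex.normSq_apply, pow_two, Complex.mul_re, Complex.mul_im, Complex.conj_re,
      Complex.conj_im]
    ring
  simp only [D, G]
  linear_combination (1 - Complex.normSq (V ω i i)) ^ p * Complex.normSq (V ω i k) * hq -
    (1 - Complex.normSq (V ω i i)) ^ p * (q * Complex.normSq (V ω i j) ^ (q - 1)) * hz

/-- `integral_diag_rotation` summed over `k ≠ i`. -/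
lemma integral_diag_succ (hV : IsCOE V P) (i : Fin N) (m : ℕ) :
    (N + 2 * m + 1) * ∫ ω, (1 - Complex.normSq (V ω i i)) ^ (m + 1) ∂P =
      (N + 2 * m - 1) * ∫ ω, (1 - Complex.normSq (V ω i i)) ^ m ∂P := by
  have hnsq := Complex.continuous_normSq
  have hN : 1 ≤ N := Nat.one_le_of_lt i.pos
  have hsum := Finset.sum_eq_zero fun k (hk : k ∈ Finset.univ.erase i) =>
    hV.integral_diag_rotation (Finset.ne_of_mem_erase hk) m
  rw [← integral_finsetSum _ fun k _ => hV.integrable_comp (G := fun M =>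
    (1 - Complex.normSq (M i i)) ^ m * (2 * Complex.normSq (M i k) - Complex.normSq (M i i)) -
      2 * m * (1 - Complex.normSq (M i i)) ^ (m - 1) * Complex.normSq (M i i) *
        Complex.normSq (M i k)) (by fun_prop)] at hsum
  rw [← sub_eq_zero, ← integral_const_mul, ← integral_const_mul, ← integral_sub
    ((hV.integrable_comp (G := fun M => (1 - Complex.normSq (M i i)) ^ (m + 1))
      (by fun_prop)).const_mul _)
    ((hV.integrable_comp (G := fun M => (1 - Complex.normSq (M i i)) ^ m)
      (by fun_prop)).const_mul _), ← hsum]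
  refine integral_congr_ae (hV.unitary.mono fun ω h => ?_)
  have hrow := sum_normSq_row h i
  rw [← Finset.add_sum_erase _ _ (Finset.mem_univ i)] at hrow
  -- The truncated exponent `m - 1` is harmless, as the factor `m` vanishes for `m = 0`.
  have hm : (m : ℝ) * (1 - Complex.normSq (V ω i i)) ^ m =
      m * (1 - Complex.normSq (V ω i i)) ^ (m - 1) * (1 - Complex.normSq (V ω i i)) := by
    cases m <;> simp [pow_succ, mul_assoc]
  simp only [Finset.sum_sub_distrib, ← Finset.mul_sum, Finset.sum_const,
    Finset.card_erase_of_mem (Finset.mem_univ i), Finset.card_univ, Fintype.card_fin,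
    nsmul_eq_mul, Nat.cast_sub hN, Nat.cast_one, eq_sub_of_add_eq' hrow]
  linear_combination -2 * Complex.normSq (V ω i i) * hm

/-- `integral_offDiag_rotation` summed over `k ∉ {i, j}`. -/
lemma integral_offDiag_succ (hV : IsCOE V P) {i j : Fin N} (hij : i ≠ j) (p q : ℕ) :
    (N - 1 + q) * ∫ ω, (1 - Complex.normSq (V ω i i)) ^ p * Complex.normSq (V ω i j) ^ (q + 1) ∂P =
      (q + 1) * ∫ ω, (1 - Complex.normSq (V ω i i)) ^ (p + 1) *
        Complex.normSq (V ω i j) ^ q ∂P := by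
  have hnsq := Complex.continuous_normSq
  have hji : j ∈ Finset.univ.erase i := Finset.mem_erase.2 ⟨hij.symm, Finset.mem_univ j⟩
  have hcard : (((Finset.univ.erase i).erase j).card : ℝ) = N - 2 := by
    have h1 := Finset.card_erase_add_one hji
    have h2 := Finset.card_erase_add_one (Finset.mem_univ i)
    rw [Finset.card_univ, Fintype.card_fin, ← h1] at h2
    have h3 : (((Finset.univ.erase i).erase j).card : ℝ) + 1 + 1 = N := by exact_mod_cast h2
    linarith
  have hsum := Finset.sum_eq_zero fun k (hk : k ∈ (Finset.univ.erase i).erase j) =>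
    hV.integral_offDiag_rotation hij.symm (Finset.ne_of_mem_erase (Finset.mem_of_mem_erase hk))
      (Finset.ne_of_mem_erase hk) p q
  rw [← integral_finsetSum _ fun k _ => hV.integrable_comp (G := fun M =>
    (1 - Complex.normSq (M i i)) ^ p * Complex.normSq (M i j) ^ q *
      ((q + 1) * Complex.normSq (M i k) - Complex.normSq (M i j))) (by fun_prop)] at hsum
  rw [eq_comm, ← sub_eq_zero, ← integral_const_mul, ← integral_const_mul, ← integral_sub
    ((hV.integrable_comp (G := fun M => (1 - Complex.normSq (M i i)) ^ (p + 1) *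
      Complex.normSq (M i j) ^ q) (by fun_prop)).const_mul _)
    ((hV.integrable_comp (G := fun M => (1 - Complex.normSq (M i i)) ^ p *
      Complex.normSq (M i j) ^ (q + 1)) (by fun_prop)).const_mul _), ← hsum]
  refine integral_congr_ae (hV.unitary.mono fun ω h => ?_)
  have hrow := sum_normSq_row h i
  rw [← Finset.add_sum_erase _ _ (Finset.mem_univ i), ← Finset.add_sum_erase _ _ hji] at hrow
  simp only [← Finset.mul_sum, Finset.sum_sub_distrib, Finset.sum_const, hcard, nsmul_eq_mul,
    eq_sub_of_add_eq' (eq_sub_of_add_eq' hrow)]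
  ring

lemma integral_diag_pow (hV : IsCOE V P) (i : Fin N) (m : ℕ) :
    (N + 2 * m - 1) * ∫ ω, (1 - Complex.normSq (V ω i i)) ^ m ∂P = N - 1 := by
  induction m with
  | zero =>
    have := hV.isProbabilityMeasure
    simp
  | succ m ih =>
    have h := hV.integral_diag_succ i m
    push_cast
    linear_combination h + ih

lemma prod_mul_integral_offDiag_pow (hV : IsCOE V P) {i j : Fin N} (hij : i ≠ j) (p q : ℕ) :
    (∏ l ∈ Finset.range q, ((N : ℝ) - 1 + l)) *
        ∫ ω, (1 - Complex.normSq (V ω i i)) ^ p * Complex.normSq (V ω i j) ^ q ∂P =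
      q.factorial * ∫ ω, (1 - Complex.normSq (V ω i i)) ^ (p + q) ∂P := by
  induction q generalizing p with
  | zero => simp
  | succ q ih =>
    have h := hV.integral_offDiag_succ hij p q
    have h' := ih (p + 1)
    rw [Nat.add_right_comm p 1 q] at h'
    rw [Finset.prod_range_succ, Nat.factorial_succ, ← Nat.add_assoc]
    push_cast
    linear_combination (∏ l ∈ Finset.range q, ((N : ℝ) - 1 + l)) * h + (q + 1 : ℝ) * h'

end IsCOE

/-! ### The moments of an off-diagonal entry -/

theorem theorem4p2 {Ω : Type*} [MeasurableSpace Ω] (P : Measure Ω) (N : ℕ) (hN : 2 ≤ N)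
    (V : Ω → Matrix (Fin N) (Fin N) ℂ) (hV : IsCOE V P)
    (i j : Fin N) (hij : i ≠ j) (n : ℕ) (hn : 1 ≤ n) :
    ∫ ω, ‖V ω i j‖ ^ (2 * n) ∂P =
      (n.factorial : ℝ) /
        (((N : ℝ) + 2 * (n : ℝ) - 1) * ∏ k ∈ Finset.range (n - 1), ((N : ℝ) + (k : ℝ))) := by
  have hN' : (2 : ℝ) ≤ N := by exact_mod_cast hN
  obtain ⟨n, rfl⟩ := Nat.exists_eq_add_of_le' hn
  have hdiag := hV.integral_diag_pow i (n + 1)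
  have hoff := hV.prod_mul_integral_offDiag_pow hij 0 (n + 1)
  have hprod : ∏ l ∈ Finset.range (n + 1), ((N : ℝ) - 1 + l) =
      (N - 1) * ∏ k ∈ Finset.range n, ((N : ℝ) + k) := by
    rw [Finset.prod_range_succ']
    push_cast
    rw [add_zero, mul_comm]
    congr 1
    exact Finset.prod_congr rfl fun k _ => by ring
  have hpos : 0 < ∏ k ∈ Finset.range n, ((N : ℝ) + k) := Finset.prod_pos fun k _ => by positivity
  have hden : (0 : ℝ) < N + 2 * (n + 1 : ℕ) - 1 := by push_cast; linarith [n.cast_nonneg (α := ℝ)]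
  simp only [pow_zero, one_mul, zero_add, hprod, Complex.normSq_eq_norm_sq (V _ i j), ← pow_mul]
    at hoff
  rw [Nat.add_sub_cancel, eq_div_iff (mul_pos hden hpos).ne']
  refine mul_left_cancel₀ (show (N : ℝ) - 1 ≠ 0 by linarith) ?_
  linear_combination (N + 2 * (n + 1 : ℕ) - 1 : ℝ) * hoff + ((n + 1).factorial : ℝ) * hdiag
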